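/- Let $A$ be a finite set. A nearest neighbor $\mathbb{Z}^2$ SFT with alphabet $A$ is a nonempty set $X \subseteq A^{\mathbb{Z}^2}$ of the form $X=\{x : (x(t),x(t+\vec e_i)) \text{ is legal in direction } i \text{ for all } t\in\mathbb{Z}^2,\ i\in\{1,2\}\}$, where for each $i \in\{1,2\}$ a set of legal ordered pairs in $A\times A$ is given. For $\epsilon>0$, $X$ is $\epsilon$-full if there is a set $G\subseteq A$ with $|G|>(1-\epsilon)|A|$ such that every $g\in G$ has, in each of the four directions $\pm\vec e_1,\pm\vec e_2$, more than $(1-\epsilon)|A|$ legal neighbors. Let $(\sigma_t x)(s)=x(s+t)$. For a subshift $Y \subseteq A^{\mathbb{Z}^2}$ (a closed shift-invariant set) and a finite $S\subset\mathbb{Z}^2$, let $L_S(Y)=\{y|_S : y\in Y\}$ and, for $u \in L_S(Y)$, let $[u]=\{y\in Y : y|_S=u\}$. The topological entropy is $h(X)=\lim_{n_1,n_2\to\infty}\frac{1}{n_1n_2}\log|L_{[1,n_1]\times[1,n_2]}(X)|$, and the entropy of a shift-invariant Borel probability measure $\mu$ on $A^{\mathbb{Z}^2}$ is $h(\mu)=\lim_{n_1,n_2\to\infty}\frac{-1}{n_1n_2}\sum_{w\in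 A^{[1,n_1]\times[1,n_2]}}\mu(\{x : x|_{[1,n_1]\times[1,n_2]}=w\})\log\mu(\{x : x|_{[1,n_1]\times[1,n_2]}=w\})$ with $0\log 0=0$. A measure of maximal entropy on $X$ is a shift-invariant Borel probability measure $\mu$ with $\operatorname{supp}\mu\subseteq X$ and $h(\mu)=h(X)$. A subshift $Y$ is block gluing if there is an $n$ such that for all (finite, nonempty) rectangles $S,S'\subset\mathbb{Z}^2$, all $u\in L_S(Y)$ and $u'\in L_{S'}(Y)$, and all $t\in\mathbb{Z}^2$ for which $S$ and $S'-t$ are at $\ell^1$-distance at least $n$, one has $[u]\cap\sigma_t[u']\neq\varnothing$. Theorem. For every $\epsilon>0$ there is an $\epsilon$-full nearest neighbor $\mathbb{Z}^2$ SFT $X$ that has a unique measure of maximal entropy $\mu$, and the support of $\mu$ is not block gluing. -/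

import Mathlib

open MeasureTheory Filter Topology
open SymbolicDynamics.FullShift (shift Subshift)

namespace NearlyFull

/-- Points of the `ℤ^d` full shift over `A`. -/
abbrev Point (d : ℕ) (A : Type*) : Type _ := (Fin d → ℤ) → A

/-- The `ℓ¹` distance on `ℤ^d` (two sites are adjacent iff it equals `1`). -/
def siteDist {d : ℕ} (s t : Fin d → ℤ) : ℤ := ∑ i, |s i - t i|

/-- `L_S(X)`: the configurations of shape `S` that appear in points of `X`. -/
def language {d : ℕ} {A : Type*} (X : Set (Point d A)) (S : Finset (Fin d → ℤ)) :
    Set (S → A) :=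
  {w | ∃ x ∈ X, S.restrict x = w}

/-- The cylinder set `[w]` in `X`: the points of `X` whose restriction to `S` is `w`. -/
def cyl {d : ℕ} {A : Type*} (X : Set (Point d A)) {S : Finset (Fin d → ℤ)} (w : S → A) :
    Set (Point d A) :=
  {x | x ∈ X ∧ S.restrict x = w}

/-- The box `∏ [1, n_i]`. -/
noncomputable def box {d : ℕ} (n : Fin d → ℕ) : Finset (Fin d → ℤ) :=
  Finset.Icc (fun _ => 1) (fun i => (n i : ℤ))

/-- The topological entropy of `X` is `h`. The filter `atTop` on `Fin d → ℕ` says that all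
side lengths tend to infinity. -/
def HasTopEntropy {d : ℕ} {A : Type*} (X : Set (Point d A)) (h : ℝ) : Prop :=
  Tendsto (fun n : Fin d → ℕ =>
    (∏ i, (n i : ℝ))⁻¹ * Real.log ((language X (box n)).ncard : ℝ)) atTop (𝓝 h)

/-- The measure-theoretic entropy of `μ` is `h`. Here `Real.negMulLog p = -p * log p`, with
value `0` at `p = 0`. -/
def HasMeasureEntropy {d : ℕ} {A : Type*} [Fintype A] [MeasurableSpace A]
    (μ : Measure (Point d A)) (h : ℝ) : Prop :=
  Tendsto (fun n : Fin d → ℕ =>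
    (∏ i, (n i : ℝ))⁻¹ * ∑ w : (box n → A), Real.negMulLog (μ.real (cyl Set.univ w)))
    atTop (𝓝 h)

/-- `μ` is a measure of maximal entropy on `X`: a shift-invariant Borel probability measure
whose support is contained in `X` and whose entropy is that of `X`. -/
structure IsMME {d : ℕ} {A : Type*} [Fintype A] [TopologicalSpace A] [MeasurableSpace A]
    (X : Subshift A (Fin d → ℤ)) (μ : Measure (Point d A)) : Prop where
  prob : IsProbabilityMeasure μ
  invariant : ∀ t : Fin d → ℤ, MeasurePreserving (shift t) μ μ
  support_subset : μ.support ⊆ X.carrier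
  entropy_eq : ∃ h : ℝ, HasTopEntropy X.carrier h ∧ HasMeasureEntropy μ h

/-- Adjacency rules for a nearest neighbor `ℤ^d` SFT: `legal i a b` means that `b` may appear
at `t + e_i` when `a` appears at `t`. The forbidden pairs in direction `i` are those for which
`legal i` fails. -/
structure NNRules (d : ℕ) (A : Type*) where
  legal : Fin d → A → A → Prop

/-- The nearest neighbor `ℤ^d` SFT given by adjacency rules. -/
def NNRules.sft {d : ℕ} {A : Type*} [TopologicalSpace A] [DiscreteTopology A]
    (R : NNRules d A) : Subshift A (Fin d → ℤ) where
  carrier := {x | ∀ (t : Fin d → ℤ) (i : Fin d), R.legal i (x t) (x (t + Pi.single i 1))}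
  isClosed := by
    simp only [Set.ofPred_forall]
    refine isClosed_iInter fun t => isClosed_iInter fun i => ?_
    have h : Continuous fun x : Point d A => (x t, x (t + Pi.single i 1)) := by fun_prop
    exact (isClosed_discrete {p : A × A | R.legal i p.1 p.2}).preimage h
  mapsTo := by
    intro g x hx t i
    have h := hx (g + t) i
    rw [add_assoc] at h
    exact h

/-- `ε`-fullness. The bad letters are those not in `G`; the two cardinalities in `neighbors`
count the legal neighbors of `g` in the directions `e_i` and `-e_i`. -/
def NNRules.IsFull {d : ℕ} {A : Type*} [Fintype A] (R : NNRules d A) (ε : ℝ) : Prop :=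
  ∃ G : Set A, (1 - ε) * Fintype.card A < G.ncard ∧
    ∀ g ∈ G, ∀ i : Fin d,
      (1 - ε) * Fintype.card A < {a | R.legal i g a}.ncard ∧
      (1 - ε) * Fintype.card A < {a | R.legal i a g}.ncard

/-- Block gluing: for some `n`, any two configurations `u`, `u'` in the language of `X` whose
shapes are boxes, and any `t` such that the shape of `u` and the shape of `σ_t u'` (the shape of
`u'` translated by `-t`) are at distance at least `n`, satisfy `[u] ∩ σ_t [u'] ≠ ∅`. -/
def BlockGluing {d : ℕ} {A : Type*} (X : Set (Point d A)) : Prop :=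
  ∃ n : ℕ, ∀ a b a' b' : Fin d → ℤ, a ≤ b → a' ≤ b' →
    ∀ u ∈ language X (Finset.Icc a b), ∀ u' ∈ language X (Finset.Icc a' b'),
    ∀ t : Fin d → ℤ,
      (∀ s ∈ Finset.Icc a b, ∀ s' ∈ Finset.Icc a' b', (n : ℤ) ≤ siteDist s (s' - t)) →
      (cyl X u ∩ shift t '' cyl X u').Nonempty

end NearlyFull

/-!
Let an i.i.d. uniform field of colours drive the letters: a letter is determined by its own colour
and, only if that colour is the special one, by its neighbors in the directions `-e_i`. When there
are more than `d` colours, chains of special sites almost surely die out, so almost every colour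
field has exactly one point of the SFT above it. A pattern on a box is determined by its colours and
its letters on the lower edges, so passing to colours changes the entropy of a box by a boundary
term only. The colour field of a measure of maximal entropy is therefore uniform Bernoulli, and
the measure itself is the lift of the Bernoulli measure.

There is a single special colour among many, which makes the SFT nearly full, but the special
letters still carry information over long distances. They compare the heights of adjacent columns of
special letters: a row of `n + 1` sites whose columns are each shorter than the next one to the left
forces a column of height `n + 1` at the left of that row, hence a special letter `n` sites below
it. This defeats block gluing.
-/

namespace NearlyFull

section FiniteEntropy

open Real (negMulLog log)
open InformationTheory (klFun klFun_nonneg klFun_eq_zero_iff)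

lemma negMulLog_eq_sub_mul_klFun (p : ℝ) {q : ℝ} (hq : q ≠ 0) :
    negMulLog p = -(p * log q) + (q - p) - q * klFun (p / q) := by
  rcases eq_or_ne p 0 with rfl | hp
  · simp [InformationTheory.klFun_zero]
  · rw [InformationTheory.klFun_apply, Real.log_div hp hq, Real.negMulLog]
    field_simp
    ring

lemma sum_negMulLog_le_sum_neg_mul_log {ι : Type*} {s : Finset ι} {p q : ι → ℝ}
    (hp : ∀ i ∈ s, 0 ≤ p i) (hq : ∀ i ∈ s, 0 ≤ q i) (hpq : ∀ i ∈ s, q i = 0 → p i = 0)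
    (hsum : ∑ i ∈ s, q i ≤ ∑ i ∈ s, p i) :
    ∑ i ∈ s, negMulLog (p i) ≤ ∑ i ∈ s, -(p i * log (q i)) := by
  have hle : ∀ i ∈ s, negMulLog (p i) ≤ -(p i * log (q i)) + (q i - p i) := fun i hi => by
    rcases eq_or_ne (q i) 0 with h | h
    · simp [h, hpq i hi h]
    · rw [negMulLog_eq_sub_mul_klFun _ h]
      linarith [mul_nonneg (hq i hi) (klFun_nonneg (div_nonneg (hp i hi) (hq i hi)))]
  calc ∑ i ∈ s, negMulLog (p i) ≤ ∑ i ∈ s, (-(p i * log (q i)) + (q i - p i)) :=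
        Finset.sum_le_sum hle
    _ = ∑ i ∈ s, -(p i * log (q i)) + (∑ i ∈ s, q i - ∑ i ∈ s, p i) := by
        rw [Finset.sum_add_distrib, Finset.sum_sub_distrib]
    _ ≤ ∑ i ∈ s, -(p i * log (q i)) := by linarith

lemma sum_negMulLog_le_negMulLog_sum_add {ι : Type*} {s : Finset ι} {p : ι → ℝ} {K : ℕ}
    (hp : ∀ i ∈ s, 0 ≤ p i) (hs : s.card ≤ K) :
    ∑ i ∈ s, negMulLog (p i) ≤ negMulLog (∑ i ∈ s, p i) + (∑ i ∈ s, p i) * log K := by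
  rcases (Finset.sum_nonneg hp).eq_or_lt with hP | hP
  · have h0 := (Finset.sum_eq_zero_iff_of_nonneg hp).1 hP.symm
    rw [← hP, Finset.sum_congr rfl fun i hi => by rw [h0 i hi]]
    simp
  set P := ∑ i ∈ s, p i
  have hK : (0 : ℝ) < K := by
    have : s.Nonempty := Finset.nonempty_of_ne_empty fun h => by simp [P, h] at hP
    exact_mod_cast this.card_pos.trans_le hs
  calc ∑ i ∈ s, negMulLog (p i) ≤ ∑ i ∈ s, -(p i * log (P / K)) := by
        refine sum_negMulLog_le_sum_neg_mul_log hp (fun _ _ => by positivity)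
          (fun _ _ h => absurd h (by positivity)) ?_
        rw [Finset.sum_const, nsmul_eq_mul, mul_div_assoc', div_le_iff₀ hK, mul_comm]
        gcongr
    _ = negMulLog P + P * log K := by
        rw [Finset.sum_neg_distrib, ← Finset.sum_mul, Real.log_div hP.ne' hK.ne', Real.negMulLog]
        ring

lemma negMulLog_sum_le {ι : Type*} {s : Finset ι} {p : ι → ℝ} (hp : ∀ i ∈ s, 0 ≤ p i) :
    negMulLog (∑ i ∈ s, p i) ≤ ∑ i ∈ s, negMulLog (p i) := by
  have hle : ∀ i ∈ s, p i * log (p i) ≤ p i * log (∑ j ∈ s, p j) := fun i hi => by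
    rcases (hp i hi).eq_or_lt with h | h
    · simp [← h]
    · exact mul_le_mul_of_nonneg_left
        (Real.log_le_log h (Finset.single_le_sum hp hi)) h.le
  simp only [Real.negMulLog, neg_mul, Finset.sum_neg_distrib, Finset.sum_mul]
  exact neg_le_neg (Finset.sum_le_sum hle)

lemma eq_inv_card_of_log_card_le_sum_negMulLog {ι : Type*} [Fintype ι] {p : ι → ℝ}
    (hp : ∀ i, 0 ≤ p i) (hsum : ∑ i, p i = 1)
    (hlog : log (Fintype.card ι) ≤ ∑ i, negMulLog (p i)) (i : ι) :
    p i = (Fintype.card ι : ℝ)⁻¹ := by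
  have : Nonempty ι := ⟨i⟩
  have hcard : (0 : ℝ) < Fintype.card ι := by exact_mod_cast Fintype.card_pos
  set q : ℝ := (Fintype.card ι : ℝ)⁻¹
  have hq : 0 < q := inv_pos.2 hcard
  have hkl : ∀ i, 0 ≤ q * klFun (p i / q) := fun i =>
    mul_nonneg hq.le (klFun_nonneg (div_nonneg (hp i) hq.le))
  have hentropy : ∑ i, negMulLog (p i) = log (Fintype.card ι) - ∑ i, q * klFun (p i / q) := by
    rw [Finset.sum_congr rfl fun i _ => negMulLog_eq_sub_mul_klFun (p i) hq.ne',
      Finset.sum_sub_distrib, Finset.sum_add_distrib, Finset.sum_sub_distrib,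
      Finset.sum_neg_distrib, ← Finset.sum_mul, hsum]
    simp [q, hcard.ne']
  have hzero : q * klFun (p i / q) = 0 := by
    refine (Finset.sum_eq_zero_iff_of_nonneg fun i _ => hkl i).1 (le_antisymm ?_ ?_) i
      (Finset.mem_univ i)
    · linarith
    · exact Finset.sum_nonneg fun i _ => hkl i
  rw [mul_eq_zero_iff_left hq.ne', klFun_eq_zero_iff (div_nonneg (hp i) hq.le),
    div_eq_one_iff_eq hq.ne'] at hzero
  exact hzero

variable {Ω ι κ : Type*} [MeasurableSpace Ω] [Fintype ι]

/-- The Shannon entropy, in nats, of a finite-valued random variable `f` under `ν`. -/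
noncomputable def shannonEntropy (ν : Measure Ω) (f : Ω → ι) : ℝ :=
  ∑ i, negMulLog (ν.real (f ⁻¹' {i}))

variable {ν : Measure Ω} {f : Ω → ι}

lemma shannonEntropy_nonneg [IsProbabilityMeasure ν] : 0 ≤ shannonEntropy ν f :=
  Finset.sum_nonneg fun _ _ => Real.negMulLog_nonneg measureReal_nonneg measureReal_le_one

lemma shannonEntropy_map [MeasurableSpace ι] [MeasurableSingletonClass ι] {Ω' : Type*}
    [MeasurableSpace Ω'] {g : Ω' → Ω} {ρ : Measure Ω'} (hg : Measurable g) (hf : Measurable f) :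
    shannonEntropy (ρ.map g) f = shannonEntropy ρ (f ∘ g) := by
  simp only [shannonEntropy, Set.preimage_comp,
    map_measureReal_apply hg (hf (measurableSet_singleton _))]

section Comp

variable [MeasurableSpace ι] [MeasurableSingletonClass ι] [IsFiniteMeasure ν]

lemma measureReal_preimage_comp [DecidableEq κ] (hf : Measurable f) (g : ι → κ) (u : κ) :
    ν.real ((g ∘ f) ⁻¹' {u}) = ∑ i with g i = u, ν.real (f ⁻¹' {i}) := by
  rw [sum_measureReal_preimage_singleton _ fun i _ => hf (measurableSet_singleton i)]
  congr 1
  ext x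
  simp

lemma shannonEntropy_comp_le [Fintype κ] (hf : Measurable f) (g : ι → κ) :
    shannonEntropy ν (g ∘ f) ≤ shannonEntropy ν f := by
  classical
  calc shannonEntropy ν (g ∘ f)
      = ∑ u, negMulLog (∑ i with g i = u, ν.real (f ⁻¹' {i})) := by
        simp only [shannonEntropy, measureReal_preimage_comp hf]
    _ ≤ ∑ u, ∑ i with g i = u, negMulLog (ν.real (f ⁻¹' {i})) :=
        Finset.sum_le_sum fun u _ => negMulLog_sum_le fun _ _ => measureReal_nonneg
    _ = shannonEntropy ν f := Finset.sum_fiberwise _ _ _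

end Comp

section Probability

variable [MeasurableSpace ι] [MeasurableSingletonClass ι] [IsProbabilityMeasure ν]

lemma sum_measureReal_preimage (hf : Measurable f) : ∑ i, ν.real (f ⁻¹' {i}) = 1 := by
  rw [sum_measureReal_preimage_singleton _ fun i _ => hf (measurableSet_singleton i)]
  simp

lemma shannonEntropy_le_comp_add_log [Fintype κ] [DecidableEq κ] (hf : Measurable f) {s : Finset ι}
    (hs : ∀ᵐ x ∂ν, f x ∈ s) (g : ι → κ) {K : ℕ} (hK : ∀ u, {i ∈ s | g i = u}.card ≤ K) :
    shannonEntropy ν f ≤ shannonEntropy ν (g ∘ f) + log K := by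
  have hzero : ∀ i ∉ s, ν.real (f ⁻¹' {i}) = 0 := fun i hi => by
    rw [measureReal_eq_zero_iff]
    exact measure_mono_null (by rintro x rfl; exact hi) hs
  have hsum : ∀ u, ∑ i ∈ s with g i = u, ν.real (f ⁻¹' {i}) = ν.real ((g ∘ f) ⁻¹' {u}) :=
    fun u => by
      rw [measureReal_preimage_comp hf]
      refine Finset.sum_subset (Finset.filter_subset_filter _ (Finset.subset_univ s))
        fun i hi his => hzero i fun h => his ?_
      exact Finset.mem_filter.2 ⟨h, (Finset.mem_filter.1 hi).2⟩
  have hone : ∑ u, ν.real ((g ∘ f) ⁻¹' {u}) = 1 := by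
    simp only [measureReal_preimage_comp hf]
    rw [Finset.sum_fiberwise, sum_measureReal_preimage hf]
  calc shannonEntropy ν f = ∑ i ∈ s, negMulLog (ν.real (f ⁻¹' {i})) :=
        (Finset.sum_subset (Finset.subset_univ s) fun i _ hi => by simp [hzero i hi]).symm
    _ = ∑ u, ∑ i ∈ s with g i = u, negMulLog (ν.real (f ⁻¹' {i})) :=
        (Finset.sum_fiberwise _ _ _).symm
    _ ≤ ∑ u, (negMulLog (ν.real ((g ∘ f) ⁻¹' {u})) + ν.real ((g ∘ f) ⁻¹' {u}) * log K) := by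
        refine Finset.sum_le_sum fun u _ => ?_
        rw [← hsum u]
        exact sum_negMulLog_le_negMulLog_sum_add (fun _ _ => measureReal_nonneg) (hK u)
    _ = shannonEntropy ν (g ∘ f) + log K := by
        rw [Finset.sum_add_distrib, ← Finset.sum_mul, hone, one_mul, shannonEntropy]

lemma shannonEntropy_le_log_card (hf : Measurable f) {s : Finset ι} (hs : ∀ᵐ x ∂ν, f x ∈ s) :
    shannonEntropy ν f ≤ log s.card := by
  have h := shannonEntropy_le_comp_add_log hf hs (fun _ => ()) fun _ =>
    Finset.card_le_card (Finset.filter_subset _ _)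
  have hconst : (fun _ : ι => ()) ∘ f ⁻¹' {PUnit.unit} = Set.univ :=
    Set.eq_univ_of_forall fun _ => rfl
  simpa [shannonEntropy, hconst] using h

lemma measureReal_preimage_eq_inv_card (hf : Measurable f)
    (h : log (Fintype.card ι) ≤ shannonEntropy ν f) (i : ι) :
    ν.real (f ⁻¹' {i}) = (Fintype.card ι : ℝ)⁻¹ :=
  eq_inv_card_of_log_card_le_sum_negMulLog (fun _ => measureReal_nonneg)
    (sum_measureReal_preimage hf) h i

lemma shannonEntropy_pi_le {J : Type*} [Fintype J] [DecidableEq J] {F : J → Ω → ι}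
    (hF : ∀ j, Measurable (F j)) :
    shannonEntropy ν (fun x j => F j x) ≤ ∑ j, shannonEntropy ν (F j) := by
  classical
  have hFm : Measurable fun x j => F j x := measurable_pi_lambda _ hF
  set p : (J → ι) → ℝ := fun w => ν.real ((fun x j => F j x) ⁻¹' {w})
  set m : J → ι → ℝ := fun j i => ν.real (F j ⁻¹' {i})
  have hm : ∀ j i, ∑ w with w j = i, p w = m j i := fun j i =>
    (measureReal_preimage_comp hFm (fun w => w j) i).symm
  have hp : ∀ w, 0 ≤ p w := fun _ => measureReal_nonneg
  have hpm : ∀ w j, m j (w j) = 0 → p w = 0 := fun w j h =>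
    le_antisymm (h ▸ measureReal_mono (by rintro x rfl; rfl)) (hp w)
  calc ∑ w, negMulLog (p w) ≤ ∑ w, -(p w * log (∏ j, m j (w j))) := by
        refine sum_negMulLog_le_sum_neg_mul_log (fun w _ => hp w)
          (fun w _ => Finset.prod_nonneg fun j _ => measureReal_nonneg) (fun w _ h => ?_) ?_
        · obtain ⟨j, -, hj⟩ := Finset.prod_eq_zero_iff.1 h
          exact hpm w j hj
        · rw [sum_measureReal_preimage hFm, ← Fintype.prod_sum]
          simp [m, sum_measureReal_preimage (hF _)]
    _ = ∑ w, ∑ j, -(p w * log (m j (w j))) := by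
        refine Finset.sum_congr rfl fun w _ => ?_
        by_cases hw : p w = 0
        · simp [hw]
        · rw [Real.log_prod fun j _ h => hw (hpm w j h), Finset.mul_sum, Finset.sum_neg_distrib]
    _ = ∑ j, ∑ i, ∑ w with w j = i, -(p w * log (m j (w j))) := by
        rw [Finset.sum_comm]
        exact Finset.sum_congr rfl fun j _ => (Finset.sum_fiberwise _ _ _).symm
    _ = ∑ j, shannonEntropy ν (F j) := by
        refine Finset.sum_congr rfl fun j _ => Finset.sum_congr rfl fun i _ => ?_
        change _ = negMulLog (m j i)
        rw [Real.negMulLog, ← hm, ← Finset.sum_neg_distrib, Finset.sum_mul, hm]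
        refine Finset.sum_congr rfl fun w hw => ?_
        rw [(Finset.mem_filter.1 hw).2, neg_mul]

end Probability

end FiniteEntropy

section FullShift

variable {d : ℕ} {A : Type*}

lemma cyl_univ {S : Finset (Fin d → ℤ)} (w : S → A) :
    cyl Set.univ w = (S.restrict : Point d A → S → A) ⁻¹' {w} := by
  ext x
  simp [cyl]

lemma mem_box {n : Fin d → ℕ} {t : Fin d → ℤ} : t ∈ box n ↔ ∀ i, 1 ≤ t i ∧ t i ≤ n i := by
  simp [box, Pi.le_def, forall_and]

lemma card_box (n : Fin d → ℕ) : (box n).card = ∏ i, n i := by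
  simp [box, Pi.card_Icc]

lemma log_card_box_pi [Fintype A] (n : Fin d → ℕ) :
    Real.log (Fintype.card (box n → A)) = (∏ i, n i : ℝ) * Real.log (Fintype.card A) := by
  simp [card_box]

lemma eventually_forall_pos : ∀ᶠ n : Fin d → ℕ in atTop, ∀ i, 0 < n i :=
  (eventually_ge_atTop 1).mono fun _ hn => hn

variable [MeasurableSpace A]

lemma measurable_shift (g : Fin d → ℤ) : Measurable (shift g : Point d A → Point d A) :=
  measurable_pi_lambda _ fun _ => measurable_pi_apply _

/-- Two shift-invariant probability measures agree once they agree on all boxes `∏ [1, n_i]`,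
since every finite set of sites lies in a translate of such a box. -/
lemma eq_of_map_restrict_box_eq {μ ν : Measure (Point d A)} [IsFiniteMeasure ν]
    (hμ : ∀ g, μ.map (shift g) = μ) (hν : ∀ g, ν.map (shift g) = ν)
    (h : ∀ n : Fin d → ℕ, μ.map (box n).restrict = ν.map (box n).restrict) : μ = ν := by
  refine IsProjectiveLimit.unique (P := fun S => ν.map S.restrict) (fun S => ?_) fun S => rfl
  obtain ⟨b, hb⟩ := S.bddAbove
  obtain ⟨a, ha⟩ := S.bddBelow
  set n : Fin d → ℕ := fun i => (b i - a i + 1).toNat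
  have hmem : ∀ s ∈ S, s - (a - 1) ∈ box n := fun s hs => mem_box.2 fun i => by
    have hai : a i ≤ s i := ha hs i
    have hbi : s i ≤ b i := hb hs i
    simp only [Pi.sub_apply, Pi.one_apply, n]
    omega
  set Q : (box n → A) → S → A := fun w s => w ⟨s - (a - 1), hmem s s.2⟩
  have hQ : Measurable Q := measurable_pi_lambda _ fun _ => measurable_pi_apply _
  have hcomp : (S.restrict : Point d A → S → A) = Q ∘ (box n).restrict ∘ shift (a - 1) := by
    ext x s
    simp [Q]
  have hmap : ∀ ρ : Measure (Point d A), (∀ g, ρ.map (shift g) = ρ) →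
      ρ.map S.restrict = (ρ.map (box n).restrict).map Q := fun ρ hρ => by
    rw [hcomp, ← Measure.map_map hQ ((Finset.measurable_restrict _).comp (measurable_shift _)),
      ← Measure.map_map (Finset.measurable_restrict _) (measurable_shift _), hρ]
  exact (hmap μ hμ).trans (h n ▸ (hmap ν hν).symm)

variable [Fintype A]

lemma hasMeasureEntropy_iff {μ : Measure (Point d A)} {h : ℝ} :
    HasMeasureEntropy μ h ↔ Tendsto
      (fun n : Fin d → ℕ => (∏ i, (n i : ℝ))⁻¹ * shannonEntropy μ (box n).restrict)
      atTop (𝓝 h) := by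
  simp only [HasMeasureEntropy, cyl_univ, shannonEntropy]

lemma exists_add_eq_of_mem_box_smul {k : ℕ} {n : Fin d → ℕ} {s : Fin d → ℤ}
    (hs : s ∈ box (k • n)) :
    ∃ j : Fin d → Fin k, ∃ r ∈ box n, (fun i => (n i * j i : ℤ)) + r = s := by
  have hs' : ∀ i, 1 ≤ s i ∧ s i ≤ k * n i := by simpa [mem_box] using hs
  have hn : ∀ i, (0 : ℤ) < n i := fun i => by
    refine lt_of_le_of_ne (Int.natCast_nonneg _) fun h0 => ?_
    have := hs' i
    rw [← h0] at this
    omega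
  have hk : ∀ i, ((s i - 1) / n i).toNat < k := fun i => by
    have : (s i - 1) / n i < k := Int.ediv_lt_of_lt_mul (hn i) (by linarith [hs' i])
    have : (0 : ℤ) ≤ (s i - 1) / n i := Int.ediv_nonneg (by linarith [hs' i]) (hn i).le
    omega
  refine ⟨fun i => ⟨_, hk i⟩, fun i => (s i - 1) % n i + 1, mem_box.2 fun i => ?_,
    funext fun i => ?_⟩
  · have := Int.emod_nonneg (s i - 1) (hn i).ne'
    have := Int.emod_lt_of_pos (s i - 1) (hn i)
    omega
  · have : (0 : ℤ) ≤ (s i - 1) / n i := Int.ediv_nonneg (by linarith [hs' i]) (hn i).le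
    have := Int.mul_ediv_add_emod (s i - 1) (n i)
    simp only [Pi.add_apply, Int.toNat_of_nonneg ‹0 ≤ (s i - 1) / (n i : ℤ)›]
    omega

section Invariant

variable [MeasurableSingletonClass A] {ν : Measure (Point d A)} [IsProbabilityMeasure ν]

lemma shannonEntropy_restrict_box_smul_le (hν : ∀ g, ν.map (shift g) = ν) (k : ℕ)
    (n : Fin d → ℕ) :
    shannonEntropy ν (box (k • n)).restrict ≤ (k : ℝ) ^ d * shannonEntropy ν (box n).restrict := by
  choose j r hr hjr using fun s : box (k • n) => exists_add_eq_of_mem_box_smul s.2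
  set F : (Fin d → Fin k) → Point d A → box n → A := fun j =>
    (box n).restrict ∘ shift fun i => (n i * j i : ℤ)
  have hF : ∀ j, Measurable (F j) := fun j =>
    (Finset.measurable_restrict _).comp (measurable_shift _)
  have hcomp : ((box (k • n)).restrict : Point d A → _) =
      (fun w s => w (j s) ⟨r s, hr s⟩) ∘ fun x j => F j x := by
    ext x s
    simp [F, hjr]
  calc shannonEntropy ν (box (k • n)).restrict
      ≤ shannonEntropy ν fun x j => F j x := by
        rw [hcomp]
        exact shannonEntropy_comp_le (measurable_pi_lambda _ hF) _
    _ ≤ ∑ j, shannonEntropy ν (F j) := shannonEntropy_pi_le hF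
    _ = (k : ℝ) ^ d * shannonEntropy ν (box n).restrict := by
        simp only [F, ← shannonEntropy_map (measurable_shift _) (Finset.measurable_restrict _), hν]
        simp

lemma HasMeasureEntropy.prod_mul_le {h : ℝ} (hh : HasMeasureEntropy ν h)
    (hν : ∀ g, ν.map (shift g) = ν) (n : Fin d → ℕ) :
    (∏ i, (n i : ℝ)) * h ≤ shannonEntropy ν (box n).restrict := by
  by_cases hn : ∀ i, 0 < n i
  swap
  · obtain ⟨i, hi⟩ := not_forall.1 hn
    rw [Finset.prod_eq_zero (Finset.mem_univ i) (by simpa using hi), zero_mul]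
    exact shannonEntropy_nonneg
  have hprod : (0 : ℝ) < ∏ i, (n i : ℝ) := Finset.prod_pos fun i _ => by exact_mod_cast hn i
  have hdiv : Tendsto (fun k : ℕ => k • n) atTop atTop :=
    tendsto_atTop.2 fun b => (eventually_ge_atTop (∑ i, b i)).mono fun k hk i =>
      calc b i ≤ ∑ i, b i := Finset.single_le_sum (fun _ _ => Nat.zero_le _) (Finset.mem_univ i)
        _ ≤ k := hk
        _ ≤ k * n i := Nat.le_mul_of_pos_right k (hn i)
  rw [← le_inv_mul_iff₀ hprod]
  refine le_of_tendsto ((hasMeasureEntropy_iff.1 hh).comp hdiv) ?_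
  filter_upwards [eventually_gt_atTop 0] with k hk
  simp only [Function.comp_apply, Pi.smul_apply, smul_eq_mul, Nat.cast_mul]
  rw [Finset.prod_mul_distrib, Finset.prod_const, Finset.card_univ, Fintype.card_fin,
    mul_inv_rev, mul_assoc]
  gcongr
  rw [inv_mul_le_iff₀ (pow_pos (Nat.cast_pos.2 hk) d)]
  exact shannonEntropy_restrict_box_smul_le hν k n

end Invariant

end FullShift

section Bernoulli

variable {d : ℕ} {C : Type*} [MeasurableSpace C]

/-- The uniform Bernoulli measure: the symbols are independent and uniform on `C`. -/
noncomputable def bernoulli (d : ℕ) (C : Type*) [MeasurableSpace C] : Measure (Point d C) :=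
  Measure.infinitePi fun _ => ProbabilityTheory.uniformOn Set.univ

variable [Nonempty C]

instance [Finite C] : IsProbabilityMeasure (bernoulli d C) := by
  unfold bernoulli
  infer_instance

lemma bernoulli_map_shift [Finite C] (g : Fin d → ℤ) :
    (bernoulli d C).map (shift g) = bernoulli d C := by
  refine Measure.eq_infinitePi _ fun S t ht => ?_
  have hpre : shift g ⁻¹' Set.pi S t =
      Set.pi (S.map (addLeftEmbedding g)) fun i => t (i - g) := by
    ext U
    simp only [Set.mem_preimage, Set.mem_pi, Finset.coe_map, Set.forall_mem_image]
    simp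
  rw [Measure.map_apply (measurable_shift g) (MeasurableSet.pi S.countable_toSet fun i _ => ht i),
    hpre, bernoulli, Measure.infinitePi_pi _ fun i _ => ht _]
  simp

variable [Fintype C] [MeasurableSingletonClass C]

lemma bernoulli_restrict_preimage (S : Finset (Fin d → ℤ)) (w : S → C) :
    bernoulli d C (S.restrict ⁻¹' {w}) = (Fintype.card C : ENNReal)⁻¹ ^ S.card := by
  rw [← Measure.map_apply (Finset.measurable_restrict _) (measurableSet_singleton w), bernoulli,
    Measure.infinitePi_map_restrict, Measure.pi_singleton]
  simp [ProbabilityTheory.uniformOn_univ]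

lemma shannonEntropy_bernoulli (S : Finset (Fin d → ℤ)) :
    shannonEntropy (bernoulli d C) S.restrict = S.card * Real.log (Fintype.card C) := by
  have hcard : (Fintype.card C : ℝ) ≠ 0 := by exact_mod_cast Fintype.card_ne_zero
  simp only [shannonEntropy, measureReal_def, bernoulli_restrict_preimage]
  simp [Real.negMulLog, hcard]

lemma hasMeasureEntropy_bernoulli :
    HasMeasureEntropy (bernoulli d C) (Real.log (Fintype.card C)) := by
  refine hasMeasureEntropy_iff.2 (tendsto_const_nhds.congr' ?_)
  filter_upwards [eventually_forall_pos] with n hn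
  have hprod : (∏ i, (n i : ℝ)) ≠ 0 :=
    Finset.prod_ne_zero_iff.2 fun i _ => by exact_mod_cast (hn i).ne'
  rw [shannonEntropy_bernoulli, card_box, Nat.cast_prod, inv_mul_cancel_left₀ hprod]

lemma eq_bernoulli_of_hasMeasureEntropy {ν : Measure (Point d C)} [IsProbabilityMeasure ν]
    (hν : ∀ g, ν.map (shift g) = ν) (h : HasMeasureEntropy ν (Real.log (Fintype.card C))) :
    ν = bernoulli d C := by
  have hunif : ∀ ρ : Measure (Point d C), IsProbabilityMeasure ρ → (∀ g, ρ.map (shift g) = ρ) →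
      HasMeasureEntropy ρ (Real.log (Fintype.card C)) → ∀ (n : Fin d → ℕ) (w : box n → C),
      ρ.real ((box n).restrict ⁻¹' {w}) = (Fintype.card (box n → C) : ℝ)⁻¹ :=
    fun ρ _ hρ hent n => measureReal_preimage_eq_inv_card (Finset.measurable_restrict _)
      (by rw [log_card_box_pi]; exact hent.prod_mul_le hρ n)
  refine eq_of_map_restrict_box_eq hν bernoulli_map_shift fun n =>
    Measure.ext_of_singleton fun w => ?_
  rw [Measure.map_apply (Finset.measurable_restrict _) (measurableSet_singleton w),
    Measure.map_apply (Finset.measurable_restrict _) (measurableSet_singleton w),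
    ← measureReal_eq_measureReal_iff, hunif ν ‹_› hν h,
    hunif _ inferInstance bernoulli_map_shift hasMeasureEntropy_bernoulli]

end Bernoulli

section Chains

variable {d : ℕ} {C : Type*}

/-- The neighbor of the site `t` in direction `-e_i`. -/
def pred (i : Fin d) (t : Fin d → ℤ) : Fin d → ℤ := t - Pi.single i 1

lemma pred_self_add_single (i : Fin d) (t : Fin d → ℤ) : pred i t + Pi.single i 1 = t :=
  sub_add_cancel _ _

lemma pred_add_single_self (i : Fin d) (t : Fin d → ℤ) : pred i (t + Pi.single i 1) = t :=
  add_sub_cancel_right _ _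

lemma pred_comm (i j : Fin d) (t : Fin d → ℤ) : pred i (pred j t) = pred j (pred i t) :=
  sub_right_comm _ _ _

lemma sum_pred (i : Fin d) (t : Fin d → ℤ) : ∑ j, pred i t j = ∑ j, t j - 1 := by
  simp [pred, Finset.sum_sub_distrib]

lemma pred_mem_Icc {a b t : Fin d → ℤ} (ht : t ∈ Finset.Icc a b) {i : Fin d} (hi : t i ≠ a i) :
    pred i t ∈ Finset.Icc a b := by
  rw [Finset.mem_Icc] at ht ⊢
  refine ⟨fun j => ?_, fun j => (sub_le_self _ ?_).trans (ht.2 j)⟩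
  · have : a j ≤ t j := ht.1 j
    rcases eq_or_ne j i with rfl | hj
    · simp only [pred, Pi.sub_apply, Pi.single_eq_same]
      omega
    · simpa [pred, hj] using this
  · have : (0 : Fin d → ℤ) ≤ Pi.single i 1 := Pi.single_nonneg.2 zero_le_one
    exact this j

/-- There is a chain of `n` sites carrying the symbol `c`, starting at the given site, in which
each site is a neighbor of the preceding one in some direction `-e_i`. -/
def HasChain (U : Point d C) (c : C) : ℕ → (Fin d → ℤ) → Prop
  | 0, _ => True
  | n + 1, t => U t = c ∧ ∃ i, HasChain U c n (pred i t)

variable [MeasurableSpace C] [MeasurableSingletonClass C] [Fintype C] [Nonempty C]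

/-- Along a chain the coordinate sum decreases, so its sites are distinct and their colours are
independent; the factor `d ^ n` counts the chains. -/
lemma bernoulli_hasChain_inter_le (c : C) (n : ℕ) (t : Fin d → ℤ) (S : Finset (Fin d → ℤ))
    (hS : ∀ s ∈ S, ∑ i, t i < ∑ i, s i) :
    bernoulli d C {U | (∀ s ∈ S, U s = c) ∧ HasChain U c n t} ≤
      (d : ENNReal) ^ n * (Fintype.card C : ENNReal)⁻¹ ^ (S.card + n) := by
  induction n generalizing t S with
  | zero =>
    have hset : {U : Point d C | (∀ s ∈ S, U s = c) ∧ HasChain U c 0 t} =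
        (S.restrict : Point d C → S → C) ⁻¹' {fun _ => c} := by
      ext U
      simp [HasChain, funext_iff]
    rw [hset, bernoulli_restrict_preimage, pow_zero, one_mul, add_zero]
  | succ n ih =>
    have htS : t ∉ S := fun h => lt_irrefl _ (hS t h)
    have hsub : {U : Point d C | (∀ s ∈ S, U s = c) ∧ HasChain U c (n + 1) t} ⊆
        ⋃ i, {U | (∀ s ∈ insert t S, U s = c) ∧ HasChain U c n (pred i t)} := by
      rintro U ⟨hU, ht, i, hi⟩
      exact Set.mem_iUnion.2 ⟨i, Finset.forall_mem_insert _ _ _ |>.2 ⟨ht, hU⟩, hi⟩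
    have hinsert : ∀ i : Fin d, ∀ s ∈ insert t S, ∑ j, pred i t j < ∑ j, s j := fun i s hs => by
      rw [sum_pred]
      rcases Finset.mem_insert.1 hs with rfl | hs
      · omega
      · linarith [hS s hs]
    calc bernoulli d C {U | (∀ s ∈ S, U s = c) ∧ HasChain U c (n + 1) t}
        ≤ ∑ i, bernoulli d C {U | (∀ s ∈ insert t S, U s = c) ∧ HasChain U c n (pred i t)} :=
          (measure_mono hsub).trans (measure_iUnion_fintype_le _ _)
      _ ≤ ∑ _i : Fin d, (d : ENNReal) ^ n * (Fintype.card C : ENNReal)⁻¹ ^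
            ((insert t S).card + n) :=
          Finset.sum_le_sum fun i _ => ih _ _ (hinsert i)
      _ = (d : ENNReal) ^ (n + 1) * (Fintype.card C : ENNReal)⁻¹ ^ (S.card + (n + 1)) := by
          rw [Finset.card_insert_of_notMem htS, Finset.sum_const, Finset.card_univ,
            Fintype.card_fin, nsmul_eq_mul, ← mul_assoc, ← pow_succ', add_assoc, add_comm 1 n]

lemma ae_exists_not_hasChain (hC : d < Fintype.card C) (c : C) :
    ∀ᵐ U ∂bernoulli d C, ∀ t, ∃ n, ¬ HasChain U c n t := by
  refine ae_all_iff.2 fun t => ?_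
  have hlt : (d : ENNReal) * (Fintype.card C : ENNReal)⁻¹ < 1 := by
    rw [← div_eq_mul_inv, ENNReal.div_lt_iff (by simp) (by simp), one_mul]
    exact_mod_cast hC
  have hle : ∀ n, bernoulli d C {U | ∀ m, HasChain U c m t} ≤
      ((d : ENNReal) * (Fintype.card C : ENNReal)⁻¹) ^ n := fun n => by
    refine (measure_mono fun U hU => ?_).trans
      ((bernoulli_hasChain_inter_le c n t ∅ (by simp)).trans_eq (by simp [mul_pow]))
    exact ⟨by simp, hU n⟩
  rw [ae_iff]
  push Not
  exact le_antisymm (ge_of_tendsto' (ENNReal.tendsto_pow_atTop_nhds_zero_of_lt_one hlt) hle)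
    zero_le

end Chains

/-- Adjacency rules driven by colours: the letter at a site is determined, through `fit`, by its own
colour and the letters at the neighbors in the directions `-e_i`, and only letters of the colour
`special` depend on these neighbors. -/
structure DrivenRules (d : ℕ) (A C : Type*) extends NNRules d A where
  colour : A → C
  special : C
  fit : C → (Fin d → A) → A
  legal_iff : ∀ b f, (∀ i, legal i (f i) b) ↔ fit (colour b) f = b
  colour_fit : ∀ c f, colour (fit c f) = c
  fit_eq_fit : ∀ c, c ≠ special → ∀ f g, fit c f = fit c g

namespace DrivenRules

variable {d : ℕ} {A C : Type*} (R : DrivenRules d A C)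

/-- Updates all sites simultaneously according to the colours `U`; the points of the SFT with
colours `U` are the fixed points. -/
def step (U : Point d C) (x : Point d A) : Point d A :=
  fun t => R.fit (U t) fun i => x (pred i t)

/-- The colours of a configuration. -/
def colours (x : Point d A) : Point d C := fun t => R.colour (x t)

lemma colours_eq_of_step_eq {U : Point d C} {x : Point d A} (h : R.step U x = x) :
    R.colours x = U := by
  funext t
  rw [← h]
  exact R.colour_fit _ _

lemma iterate_step_eq_of_not_hasChain {U : Point d C} {n : ℕ} {t : Fin d → ℤ}
    (h : ¬ HasChain U R.special n t) (x y : Point d A) :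
    (R.step U)^[n] x t = (R.step U)^[n] y t := by
  induction n generalizing t with
  | zero => exact absurd trivial h
  | succ n ih =>
    rw [Function.iterate_succ_apply', Function.iterate_succ_apply']
    by_cases hU : U t = R.special
    · exact congrArg (R.fit (U t)) (funext fun i => ih fun hi => h ⟨hU, i, hi⟩)
    · exact R.fit_eq_fit _ hU _ _

section Topological

variable [TopologicalSpace A] [DiscreteTopology A]

lemma mem_sft_iff {x : Point d A} : x ∈ R.sft.carrier ↔ R.step (R.colours x) x = x := by
  simp only [funext_iff, step, colours, ← R.legal_iff]
  refine ⟨fun h t i => ?_, fun h t i => ?_⟩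
  · simpa only [pred_self_add_single] using h (pred i t) i
  · have ht := h (t + Pi.single i 1) i
    rwa [pred_add_single_self] at ht

lemma eq_of_colour_ne_special {x y : Point d A} (hx : x ∈ R.sft.carrier)
    (hy : y ∈ R.sft.carrier) {t : Fin d → ℤ} (h : R.colour (x t) = R.colour (y t))
    (hs : R.colour (x t) ≠ R.special) : x t = y t := by
  rw [← congrFun (R.mem_sft_iff.1 hx) t, ← congrFun (R.mem_sft_iff.1 hy) t]
  simp only [step, colours, ← h]
  exact R.fit_eq_fit _ hs _ _

lemma eqOn_Icc_of_eqOn_edge {x y : Point d A} (hx : x ∈ R.sft.carrier) (hy : y ∈ R.sft.carrier)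
    {a b : Fin d → ℤ} (hc : ∀ t ∈ Finset.Icc a b, R.colour (x t) = R.colour (y t))
    (he : ∀ t ∈ Finset.Icc a b, ∀ i, t i = a i → x t = y t) {t : Fin d → ℤ}
    (ht : t ∈ Finset.Icc a b) : x t = y t := by
  induction hn : (∑ i, (t i - a i)).toNat using Nat.strong_induction_on generalizing t with
  | _ n ih =>
  subst hn
  by_cases hedge : ∃ i, t i = a i
  · obtain ⟨i, hi⟩ := hedge
    exact he t ht i hi
  have hpred : ∀ i, x (pred i t) = y (pred i t) := fun i => by
    have hmem := pred_mem_Icc ht fun h => hedge ⟨i, h⟩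
    have hnonneg : 0 ≤ ∑ j, (pred i t j - a j) :=
      Finset.sum_nonneg fun j _ => sub_nonneg.2 ((Finset.mem_Icc.1 hmem).1 j)
    refine ih _ ?_ hmem rfl
    simp only [Finset.sum_sub_distrib, sum_pred] at hnonneg ⊢
    omega
  rw [← congrFun (R.mem_sft_iff.1 hx) t, ← congrFun (R.mem_sft_iff.1 hy) t]
  simp only [step, colours, hc t ht, hpred]

variable [Nonempty A]

/-- The point of the SFT with colours `U`: the limit of the iterates of `step U`, which does not
depend on the starting point when `U` has no infinite chains of special sites. Otherwise the value
is junk. -/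
noncomputable def decode (U : Point d C) : Point d A := fun t =>
  limUnder atTop fun n => (R.step U)^[n] (fun _ => Classical.arbitrary A) t

lemma eventually_iterate_step_eq_decode {U : Point d C} {t : Fin d → ℤ}
    (h : ∃ n, ¬ HasChain U R.special n t) (x : Point d A) :
    ∀ᶠ n in atTop, (R.step U)^[n] x t = R.decode U t := by
  obtain ⟨n, hn⟩ := h
  have hconst : ∀ y, ∀ m ≥ n, (R.step U)^[m] y t = (R.step U)^[n] x t := fun y m hm => by
    obtain ⟨k, rfl⟩ := Nat.exists_eq_add_of_le hm
    rw [Function.iterate_add_apply]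
    exact R.iterate_step_eq_of_not_hasChain hn _ _
  have hdecode : R.decode U t = (R.step U)^[n] x t :=
    (tendsto_atTop_of_eventually_const (hconst _)).limUnder_eq
  filter_upwards [eventually_ge_atTop n] with m hm
  rw [hdecode, hconst x m hm]

lemma step_decode {U : Point d C} (h : ∀ t, ∃ n, ¬ HasChain U R.special n t) :
    R.step U (R.decode U) = R.decode U := by
  funext t
  set x₀ : Point d A := fun _ => Classical.arbitrary A
  obtain ⟨n, hpred, hsucc⟩ := ((eventually_all.2 fun i =>
    R.eventually_iterate_step_eq_decode (h (pred i t)) x₀).and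
      ((tendsto_add_atTop_nat 1).eventually
        (R.eventually_iterate_step_eq_decode (h t) x₀))).exists
  rw [← hsucc, Function.iterate_succ_apply']
  simp only [step, hpred]

lemma decode_mem_sft {U : Point d C} (h : ∀ t, ∃ n, ¬ HasChain U R.special n t) :
    R.decode U ∈ R.sft.carrier := by
  rw [mem_sft_iff, R.colours_eq_of_step_eq (R.step_decode h), R.step_decode h]

lemma decode_colours {x : Point d A} (hx : x ∈ R.sft.carrier)
    (h : ∀ t, ∃ n, ¬ HasChain (R.colours x) R.special n t) : R.decode (R.colours x) = x := by
  funext t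
  obtain ⟨n, hn⟩ := (R.eventually_iterate_step_eq_decode (h t) x).exists
  rw [← hn, Function.iterate_fixed (R.mem_sft_iff.1 hx)]

end Topological

lemma measurableSet_sft [Finite A] [TopologicalSpace A] [DiscreteTopology A] [MeasurableSpace A]
    [OpensMeasurableSpace A] : MeasurableSet R.sft.carrier :=
  R.sft.isClosed.measurableSet

section Measurable

variable [MeasurableSpace A] [MeasurableSingletonClass A] [MeasurableSpace C]

lemma measurable_colours [Countable A] : Measurable R.colours :=
  measurable_pi_lambda _ fun t => Measurable.of_discrete.comp (measurable_pi_apply t)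

lemma map_colours_map_shift [Countable A] {ν : Measure (Point d A)}
    (hν : ∀ g, ν.map (shift g) = ν) (g : Fin d → ℤ) :
    (ν.map R.colours).map (shift g) = ν.map R.colours := by
  conv_rhs => rw [← hν g]
  rw [Measure.map_map (measurable_shift g) R.measurable_colours,
    Measure.map_map R.measurable_colours (measurable_shift g)]
  rfl

lemma measurable_iterate_step [Countable A] [MeasurableSingletonClass C] [Countable C] (n : ℕ)
    (x : Point d A) (t : Fin d → ℤ) : Measurable fun U : Point d C => (R.step U)^[n] x t := by
  induction n generalizing t with
  | zero => exact measurable_const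
  | succ n ih =>
    simp only [Function.iterate_succ_apply']
    have hfit : Measurable fun p : C × (Fin d → A) => R.fit p.1 p.2 := Measurable.of_discrete
    exact hfit.comp ((measurable_pi_apply t).prodMk (measurable_pi_lambda _ fun i => ih (pred i t)))

end Measurable

section Lift

variable [TopologicalSpace A] [DiscreteTopology A] [MeasurableSpace A] [BorelSpace A]
  [Nonempty A] [MeasurableSpace C]

/-- The law of the point of the SFT whose colours are independent and uniform. -/
noncomputable def bernoulliLift : Measure (Point d A) := (bernoulli d C).map R.decode

variable [MeasurableSingletonClass C] [Fintype C] [Nonempty C]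

lemma aemeasurable_decode [Countable A] (hC : d < Fintype.card C) :
    AEMeasurable R.decode (bernoulli d C) := by
  refine aemeasurable_pi_iff.2 fun t => aemeasurable_of_tendsto_metrizable_ae atTop
    (fun n => (R.measurable_iterate_step n (fun _ => Classical.arbitrary A) t).aemeasurable) ?_
  filter_upwards [ae_exists_not_hasChain hC R.special] with U hU
  exact tendsto_nhds_of_eventually_eq (R.eventually_iterate_step_eq_decode (hU t) _)

lemma isProbabilityMeasure_bernoulliLift [Countable A] (hC : d < Fintype.card C) :
    IsProbabilityMeasure R.bernoulliLift :=
  Measure.isProbabilityMeasure_map (R.aemeasurable_decode hC)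

lemma bernoulliLift_map_colours [Countable A] (hC : d < Fintype.card C) :
    R.bernoulliLift.map R.colours = bernoulli d C := by
  rw [bernoulliLift, AEMeasurable.map_map_of_aemeasurable R.measurable_colours.aemeasurable
    (R.aemeasurable_decode hC)]
  refine (Measure.map_congr ?_).trans Measure.map_id
  filter_upwards [ae_exists_not_hasChain hC R.special] with U hU
  exact R.colours_eq_of_step_eq (R.step_decode hU)

lemma eq_bernoulliLift_of_map_colours_eq [Countable A] (hC : d < Fintype.card C)
    {ν : Measure (Point d A)} (hX : ∀ᵐ x ∂ν, x ∈ R.sft.carrier)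
    (hν : ν.map R.colours = bernoulli d C) :
    ν = R.bernoulliLift := by
  have hdecode := R.aemeasurable_decode hC
  have hchain := ae_exists_not_hasChain hC R.special
  rw [← hν] at hdecode hchain
  rw [bernoulliLift, ← hν, AEMeasurable.map_map_of_aemeasurable hdecode
    R.measurable_colours.aemeasurable]
  refine Measure.map_id.symm.trans (Measure.map_congr ?_)
  filter_upwards [hX, ae_of_ae_map R.measurable_colours.aemeasurable hchain] with x hx hc
  exact (R.decode_colours hx hc).symm

variable [Finite A]

lemma bernoulliLift_ae_mem_sft (hC : d < Fintype.card C) :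
    ∀ᵐ x ∂(R.bernoulliLift), x ∈ R.sft.carrier := by
  refine (ae_map_iff (R.aemeasurable_decode hC) R.measurableSet_sft).2 ?_
  filter_upwards [ae_exists_not_hasChain hC R.special] with U hU
  exact R.decode_mem_sft hU

lemma bernoulliLift_map_shift (hC : d < Fintype.card C) (g : Fin d → ℤ) :
    R.bernoulliLift.map (shift g) = R.bernoulliLift := by
  refine R.eq_bernoulliLift_of_map_colours_eq hC ?_ ?_
  · refine (ae_map_iff (measurable_shift g).aemeasurable R.measurableSet_sft).2 ?_
    filter_upwards [R.bernoulliLift_ae_mem_sft hC] with x hx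
    exact R.sft.mapsTo g hx
  · have hcomm : R.colours ∘ shift g = shift g ∘ R.colours := rfl
    rw [Measure.map_map R.measurable_colours (measurable_shift g), hcomm,
      ← Measure.map_map (measurable_shift g) R.measurable_colours,
      R.bernoulliLift_map_colours hC, bernoulli_map_shift]

lemma support_bernoulliLift_subset (hC : d < Fintype.card C) :
    R.bernoulliLift.support ⊆ R.sft.carrier :=
  Measure.support_subset_of_isClosed R.sft.isClosed (R.bernoulliLift_ae_mem_sft hC)

/-- Near such an `x`, a box reaching below `a` has no special sites on its lower edges, so that the
colours on the box determine the letters. -/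
lemma mem_support_bernoulliLift (hC : d < Fintype.card C) {x : Point d A}
    (hx : x ∈ R.sft.carrier) {a : Fin d → ℤ} (ha : ∀ t, R.colour (x t) = R.special → a ≤ t) :
    x ∈ R.bernoulliLift.support := by
  refine (Measure.mem_support_iff_forall x).2 fun V hV => ?_
  obtain ⟨S, W, hW, hSV⟩ := Filter.mem_pi'.1 (nhds_pi (a := x) ▸ hV)
  obtain ⟨l, hl⟩ := (insert (a - 1) S).bddBelow
  obtain ⟨u, hu⟩ := S.bddAbove
  set w := (Finset.Icc l u).restrict (R.colours x)
  have hpos : 0 < R.bernoulliLift (R.colours ⁻¹' ((Finset.Icc l u).restrict ⁻¹' {w})) := by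
    rw [← Measure.map_apply R.measurable_colours
      (Finset.measurable_restrict _ (measurableSet_singleton w)), R.bernoulliLift_map_colours hC,
      bernoulli_restrict_preimage]
    exact ENNReal.pow_pos (ENNReal.inv_pos.2 (ENNReal.natCast_ne_top _)) _
  refine hpos.trans_le (measure_mono_ae ?_)
  filter_upwards [R.bernoulliLift_ae_mem_sft hC] with y hy hyw
  have hcolour : ∀ t ∈ Finset.Icc l u, R.colour (x t) = R.colour (y t) := fun t ht =>
    (congrFun hyw ⟨t, ht⟩).symm
  have hedge : ∀ t ∈ Finset.Icc l u, ∀ i, t i = l i → x t = y t := fun t ht i hi => by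
    refine R.eq_of_colour_ne_special hx hy (hcolour t ht) fun hs => ?_
    have hat : a i ≤ t i := ha t hs i
    have hla : l i ≤ a i - 1 := hl (Finset.mem_insert_self _ _) i
    omega
  refine hSV fun s hs => ?_
  have hsIcc : s ∈ Finset.Icc l u := Finset.mem_Icc.2 ⟨hl (Finset.mem_insert_of_mem hs), hu hs⟩
  rw [← R.eqOn_Icc_of_eqOn_edge hx hy hcolour hedge hsIcc]
  exact mem_of_mem_nhds (hW s)

end Lift

end DrivenRules

section BoxEdge

variable {d : ℕ}

/-- The sites of `box n` having a neighbor outside the box in some direction `-e_i`. -/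
noncomputable def boxEdge (n : Fin d → ℕ) : Finset (Fin d → ℤ) := {t ∈ box n | ∃ i, t i = 1}

lemma card_boxEdge_le (n : Fin d → ℕ) :
    (boxEdge n).card ≤ ∑ i, ∏ j ∈ Finset.univ.erase i, n j := by
  have hsub : boxEdge n ⊆ Finset.univ.biUnion fun i => box (Function.update n i 1) := by
    intro t ht
    obtain ⟨htn, i, hi⟩ := Finset.mem_filter.1 ht
    refine Finset.mem_biUnion.2 ⟨i, Finset.mem_univ i, mem_box.2 fun j => ?_⟩
    rcases eq_or_ne j i with rfl | hj
    · simp [hi]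
    · simpa [hj] using mem_box.1 htn j
  refine (Finset.card_le_card hsub).trans (Finset.card_biUnion_le.trans_eq ?_)
  refine Finset.sum_congr rfl fun i _ => ?_
  rw [card_box, Finset.prod_update_of_mem (Finset.mem_univ i), one_mul,
    Finset.sdiff_singleton_eq_erase]

lemma tendsto_inv_prod_mul_card_boxEdge :
    Tendsto (fun n : Fin d → ℕ => (∏ i, (n i : ℝ))⁻¹ * (boxEdge n).card) atTop (𝓝 0) := by
  have hlim : Tendsto (fun n : Fin d → ℕ => ∑ i, (n i : ℝ)⁻¹) atTop (𝓝 0) := by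
    rw [← Finset.sum_const_zero (s := (Finset.univ : Finset (Fin d)))]
    refine tendsto_finsetSum _ fun i _ => tendsto_inv_atTop_zero.comp
      (tendsto_natCast_atTop_atTop.comp (tendsto_atTop.2 fun b => ?_))
    exact (eventually_ge_atTop fun _ => b).mono fun _ hn => hn i
  refine squeeze_zero' (Eventually.of_forall fun n => by positivity) ?_ hlim
  filter_upwards [eventually_forall_pos] with n hn
  have hn' : ∀ i, (0 : ℝ) < n i := fun i => Nat.cast_pos.2 (hn i)
  rw [inv_mul_le_iff₀ (Finset.prod_pos fun i _ => hn' i), Finset.mul_sum]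
  calc ((boxEdge n).card : ℝ) ≤ ∑ i, ∏ j ∈ Finset.univ.erase i, (n j : ℝ) := by
        exact_mod_cast card_boxEdge_le n
    _ = ∑ i, (∏ j, (n j : ℝ)) * (n i : ℝ)⁻¹ := by
        refine Finset.sum_congr rfl fun i hi => ?_
        rw [← Finset.prod_erase_mul _ _ hi, mul_inv_cancel_right₀ (hn' i).ne']

lemma tendsto_inv_prod_mul_iff {f g : (Fin d → ℕ) → ℝ} {c : ℝ} (hfg : ∀ n, f n ≤ g n)
    (hgf : ∀ n, g n ≤ f n + (boxEdge n).card * c) {h : ℝ} :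
    Tendsto (fun n => (∏ i, (n i : ℝ))⁻¹ * f n) atTop (𝓝 h) ↔
      Tendsto (fun n => (∏ i, (n i : ℝ))⁻¹ * g n) atTop (𝓝 h) := by
  have hinv : ∀ n : Fin d → ℕ, (0 : ℝ) ≤ (∏ i, (n i : ℝ))⁻¹ := fun n => by positivity
  have hdiff : Tendsto (fun n : Fin d → ℕ => (∏ i, (n i : ℝ))⁻¹ * (g n - f n)) atTop (𝓝 0) := by
    refine squeeze_zero (fun n => mul_nonneg (hinv n) (sub_nonneg.2 (hfg n))) (fun n => ?_)
      (by simpa using tendsto_inv_prod_mul_card_boxEdge.mul_const c)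
    rw [mul_assoc]
    exact mul_le_mul_of_nonneg_left (by linarith [hgf n]) (hinv n)
  refine ⟨fun hf => ?_, fun hg => ?_⟩
  · simpa [mul_sub] using hf.add hdiff
  · simpa [mul_sub] using hg.sub hdiff

end BoxEdge

namespace DrivenRules

variable {d : ℕ} {A C : Type*} (R : DrivenRules d A C)

section Entropy

lemma shannonEntropy_map_colours [Countable A] [MeasurableSpace A] [MeasurableSingletonClass A]
    [Fintype C] [MeasurableSpace C] [MeasurableSingletonClass C] {ν : Measure (Point d A)}
    (n : Fin d → ℕ) :
    shannonEntropy (ν.map R.colours) (box n).restrict =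
      shannonEntropy ν ((fun w s => R.colour (w s)) ∘ (box n).restrict) :=
  shannonEntropy_map R.measurable_colours (Finset.measurable_restrict _)

lemma shannonEntropy_map_colours_le [Fintype A] [MeasurableSpace A] [MeasurableSingletonClass A]
    [Fintype C] [MeasurableSpace C] [MeasurableSingletonClass C] {ν : Measure (Point d A)}
    [IsProbabilityMeasure ν] (n : Fin d → ℕ) :
    shannonEntropy (ν.map R.colours) (box n).restrict ≤ shannonEntropy ν (box n).restrict := by
  rw [shannonEntropy_map_colours]
  exact shannonEntropy_comp_le (Finset.measurable_restrict _) _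

variable [TopologicalSpace A] [DiscreteTopology A]

open Classical in
lemma card_language_colours_le [Fintype A] (n : Fin d → ℕ) (u : box n → C) :
    {w ∈ (language R.sft.carrier (box n)).toFinset | (fun s => R.colour (w s)) = u}.card ≤
      Fintype.card A ^ (boxEdge n).card := by
  set toEdge : (box n → A) → boxEdge n → A := fun w s => w ⟨s, Finset.filter_subset _ _ s.2⟩
  refine (Finset.card_le_card_of_injOn (t := Finset.univ) toEdge
    (fun _ _ => Finset.mem_univ _) fun v hv w hw hvw => ?_).trans_eq (by simp)
  obtain ⟨hv, hvu⟩ := Finset.mem_filter.1 hv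
  obtain ⟨hw, hwu⟩ := Finset.mem_filter.1 hw
  obtain ⟨x, hx, rfl⟩ := Set.mem_toFinset.1 hv
  obtain ⟨y, hy, rfl⟩ := Set.mem_toFinset.1 hw
  funext t
  refine R.eqOn_Icc_of_eqOn_edge hx hy (fun s hs => ?_) (fun s hs i hi => ?_) t.2
  · exact congrFun (hvu.trans hwu.symm) ⟨s, hs⟩
  · exact congrFun hvw ⟨s, Finset.mem_filter.2 ⟨hs, i, hi⟩⟩

lemma log_ncard_language_le [Fintype A] [Nonempty A] [Fintype C] [Nonempty C]
    [MeasurableSpace C] [MeasurableSingletonClass C] (n : Fin d → ℕ) :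
    Real.log (language R.sft.carrier (box n)).ncard ≤
      shannonEntropy (bernoulli d C) (box n).restrict +
        (boxEdge n).card * Real.log (Fintype.card A) := by
  classical
  have hcard : (language R.sft.carrier (box n)).ncard ≤
      Fintype.card A ^ (boxEdge n).card * Fintype.card C ^ (box n).card := by
    rw [Set.ncard_eq_toFinset_card']
    refine (Finset.card_le_mul_card_image _ _ fun u _ => R.card_language_colours_le n u).trans ?_
    gcongr
    simpa using Finset.card_le_univ
      ((language R.sft.carrier (box n)).toFinset.image fun w s => R.colour (w s))
  have hA : (Fintype.card A : ℝ) ≠ 0 := by exact_mod_cast Fintype.card_ne_zero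
  have hC : (Fintype.card C : ℝ) ≠ 0 := by exact_mod_cast Fintype.card_ne_zero
  rw [shannonEntropy_bernoulli, add_comm, ← Real.log_pow, ← Real.log_pow,
    ← Real.log_mul (pow_ne_zero _ hA) (pow_ne_zero _ hC)]
  rcases (language R.sft.carrier (box n)).ncard.eq_zero_or_pos with h0 | hpos
  · rw [h0, Nat.cast_zero, Real.log_zero]
    exact_mod_cast Real.log_natCast_nonneg _
  · exact Real.log_le_log (Nat.cast_pos.2 hpos) (by exact_mod_cast hcard)

lemma ae_restrict_mem_language [MeasurableSpace A] {ν : Measure (Point d A)}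
    (hν : ∀ᵐ x ∂ν, x ∈ R.sft.carrier) (n : Fin d → ℕ) :
    ∀ᵐ x ∂ν, ((box n).restrict x : box n → A) ∈ language R.sft.carrier (box n) :=
  hν.mono fun x hx => ⟨x, hx, rfl⟩

variable [MeasurableSpace A] [BorelSpace A] [Fintype C] [MeasurableSpace C]
  [MeasurableSingletonClass C]

lemma shannonEntropy_le_map_colours_add [Fintype A] {ν : Measure (Point d A)}
    [IsProbabilityMeasure ν] (hν : ∀ᵐ x ∂ν, x ∈ R.sft.carrier) (n : Fin d → ℕ) :
    shannonEntropy ν (box n).restrict ≤ shannonEntropy (ν.map R.colours) (box n).restrict +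
      (boxEdge n).card * Real.log (Fintype.card A) := by
  classical
  rw [shannonEntropy_map_colours, ← Real.log_pow, ← Nat.cast_pow]
  exact shannonEntropy_le_comp_add_log (Finset.measurable_restrict _)
    ((R.ae_restrict_mem_language hν n).mono fun _ => Set.mem_toFinset.2) _
    (R.card_language_colours_le n)

lemma hasMeasureEntropy_map_colours_iff [Fintype A] {ν : Measure (Point d A)}
    [IsProbabilityMeasure ν] (hν : ∀ᵐ x ∂ν, x ∈ R.sft.carrier) {h : ℝ} :
    HasMeasureEntropy (ν.map R.colours) h ↔ HasMeasureEntropy ν h := by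
  rw [hasMeasureEntropy_iff, hasMeasureEntropy_iff]
  exact tendsto_inv_prod_mul_iff R.shannonEntropy_map_colours_le
    (R.shannonEntropy_le_map_colours_add hν)

variable [Nonempty A] [Nonempty C]

lemma shannonEntropy_bernoulli_le_log_ncard_language [Finite A] (hC : d < Fintype.card C)
    (n : Fin d → ℕ) :
    shannonEntropy (bernoulli d C) (box n).restrict ≤
      Real.log (language R.sft.carrier (box n)).ncard := by
  classical
  have := Fintype.ofFinite A
  have := R.isProbabilityMeasure_bernoulliLift hC
  rw [← R.bernoulliLift_map_colours hC, Set.ncard_eq_toFinset_card']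
  exact (R.shannonEntropy_map_colours_le n).trans (shannonEntropy_le_log_card
    (Finset.measurable_restrict _)
    ((R.ae_restrict_mem_language (R.bernoulliLift_ae_mem_sft hC) n).mono fun _ =>
      Set.mem_toFinset.2))

lemma hasTopEntropy_sft [Finite A] (hC : d < Fintype.card C) :
    HasTopEntropy R.sft.carrier (Real.log (Fintype.card C)) := by
  have := Fintype.ofFinite A
  exact (tendsto_inv_prod_mul_iff (R.shannonEntropy_bernoulli_le_log_ncard_language hC)
    R.log_ncard_language_le).1 (hasMeasureEntropy_iff.1 hasMeasureEntropy_bernoulli)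

variable [Fintype A]

lemma isMME_bernoulliLift (hC : d < Fintype.card C) : IsMME R.sft R.bernoulliLift := by
  have := R.isProbabilityMeasure_bernoulliLift hC
  refine ⟨this, fun t => ⟨measurable_shift t, R.bernoulliLift_map_shift hC t⟩,
    R.support_bernoulliLift_subset hC, _, R.hasTopEntropy_sft hC, ?_⟩
  rw [← R.hasMeasureEntropy_map_colours_iff (R.bernoulliLift_ae_mem_sft hC),
    R.bernoulliLift_map_colours hC]
  exact hasMeasureEntropy_bernoulli

lemma eq_bernoulliLift_of_isMME (hC : d < Fintype.card C) {ν : Measure (Point d A)}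
    (hν : IsMME R.sft ν) : ν = R.bernoulliLift := by
  have := hν.prob
  have hX : ∀ᵐ x ∂ν, x ∈ R.sft.carrier :=
    mem_of_superset Measure.support_mem_ae hν.support_subset
  obtain ⟨h, htop, hent⟩ := hν.entropy_eq
  rw [tendsto_nhds_unique htop (R.hasTopEntropy_sft hC),
    ← R.hasMeasureEntropy_map_colours_iff hX] at hent
  have := Measure.isProbabilityMeasure_map (μ := ν) R.measurable_colours.aemeasurable
  exact R.eq_bernoulliLift_of_map_colours_eq hC hX (eq_bernoulli_of_hasMeasureEntropy
    (R.map_colours_map_shift fun g => (hν.invariant g).map_eq) hent)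

end Entropy

end DrivenRules

/-- The alphabet: `N` free letters, and special letters `special p q` recording the marks `p` of the
letter to the left and `q` of the letter below. -/
inductive Letter (N : ℕ)
  | free (i : Fin N)
  | special (p q : Option Bool)

namespace Letter

variable {N : ℕ}

/-- The letters as a disjoint union, for counting them. -/
def equivSum (N : ℕ) : Letter N ≃ Fin N ⊕ (Option Bool × Option Bool) where
  toFun
    | free i => .inl i
    | special p q => .inr (p, q)
  invFun := Sum.elim free fun m => special m.1 m.2
  left_inv := by rintro (_ | _) <;> rfl
  right_inv := by rintro (_ | _) <;> rfl

instance : Fintype (Letter N) := Fintype.ofEquiv _ (equivSum N).symm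
instance : TopologicalSpace (Letter N) := ⊥
instance : DiscreteTopology (Letter N) := ⟨rfl⟩
instance : MeasurableSpace (Letter N) := ⊤
instance : DiscreteMeasurableSpace (Letter N) := ⟨fun _ => trivial⟩
instance : BorelSpace (Letter N) := ⟨by rw [borel_eq_top_of_discrete]; rfl⟩
instance : Nonempty (Letter N) := ⟨special none none⟩

lemma card_letter : Fintype.card (Letter N) = N + 9 := by
  simp [Fintype.card_congr (equivSum N)]

lemma free_injective : Function.Injective (free : Fin N → Letter N) := fun _ _ => free.inj

/-- The colour of a letter: special letters share the colour `0`. -/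
def colour : Letter N → Fin (N + 1)
  | free i => i.succ
  | special _ _ => 0

/-- The mark shown to the right: whether the letter is special and, if so, whether the letter below
it is special too. -/
def hMark : Letter N → Option Bool
  | free _ => none
  | special _ q => some q.isSome

/-- The mark shown upwards: whether the letter is special and, if so, whether the column of special
letters going down from it is shorter than the one going down from its left neighbor. These columns
are compared with the letters to the left and below alone: either the column on the left is empty,
or the column here consists of a single letter, or both shrink by one when moving down. -/
def vMark : Letter N → Option Bool
  | free _ => none
  | special none _ => some false
  | special (some b) none => some b
  | special (some _) (some b) => some b

/-- Free letters may appear anywhere; a special letter has to record the marks of its neighbors. -/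
def Legal : Fin 2 → Letter N → Letter N → Prop
  | _, _, free _ => True
  | 0, a, special p _ => hMark a = p
  | 1, a, special _ q => vMark a = q

lemma colour_eq_zero_of_hMark_eq {a b : Letter N} (h : Legal 1 b a) (ha : hMark a = some true) :
    colour b = 0 := by
  rcases a with _ | ⟨_, _ | _⟩ <;> rcases b with _ | _ <;> simp_all [Legal, hMark, vMark, colour]

lemma colour_left_eq_zero_and_of_vMark_eq {a b c : Letter N} (ha : Legal 0 a c) (hb : Legal 1 b c)
    (hc : vMark c = some true) :
    colour a = 0 ∧ (vMark b = some true ∨ colour b ≠ 0 ∧ hMark a = some true) := by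
  rcases c with _ | ⟨_ | p, _ | q⟩ <;> rcases a with _ | _ <;> rcases b with _ | ⟨_ | _, _ | _⟩ <;>
    simp_all [Legal, hMark, vMark, colour]

end Letter

open Letter

variable {N : ℕ}

/-- The nearest neighbor rules of the example, driven by the free letters and the symbol `0`. -/
def columnRules (N : ℕ) : DrivenRules 2 (Letter N) (Fin (N + 1)) where
  legal := Legal
  colour := colour
  special := 0
  fit c f := Fin.cases (special (hMark (f 0)) (vMark (f 1))) free c
  legal_iff
    | free _, _ => by simp [Legal, colour]
    | special _ _, _ => by simp [Legal, colour]
  colour_fit c _ := by refine Fin.cases ?_ (fun i => ?_) c <;> rfl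
  fit_eq_fit c hc _ _ := by
    obtain ⟨i, rfl⟩ := Fin.exists_succ_eq.2 hc
    rfl

lemma isFull_columnRules {ε : ℝ} (hN : 9 < ε * (N + 9)) : (columnRules N).IsFull ε := by
  have hcard : ∀ S : Set (Letter N), Set.range free ⊆ S →
      (1 - ε) * Fintype.card (Letter N) < S.ncard := fun S hS => by
    have hle : N ≤ S.ncard := by
      simpa [Set.ncard_range_of_injective free_injective] using Set.ncard_le_ncard hS S.toFinite
    have : (N : ℝ) ≤ S.ncard := by exact_mod_cast hle
    rw [card_letter]
    push_cast
    linarith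
  refine ⟨Set.range free, hcard _ subset_rfl, ?_⟩
  rintro _ ⟨g, rfl⟩ i
  refine ⟨hcard _ ?_, hcard _ fun a _ => trivial⟩
  rintro _ ⟨j, rfl⟩
  trivial

/-- The `n` sites going down from the given one all carry special letters. -/
def HasColumn (x : Point 2 (Letter N)) : ℕ → (Fin 2 → ℤ) → Prop
  | 0, _ => True
  | n + 1, t => colour (x t) = 0 ∧ HasColumn x n (pred 1 t)

lemma legal_pred {x : Point 2 (Letter N)} (hx : x ∈ (columnRules N).sft.carrier) (i : Fin 2)
    (t : Fin 2 → ℤ) : Legal i (x (pred i t)) (x t) := by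
  conv_rhs => rw [← pred_self_add_single i t]
  exact hx (pred i t) i

lemma HasColumn.pred_zero {x : Point 2 (Letter N)} (hx : x ∈ (columnRules N).sft.carrier) {n : ℕ}
    {t : Fin 2 → ℤ} (h : HasColumn x n t) (ht : vMark (x t) = some true) :
    HasColumn x (n + 1) (pred 0 t) := by
  induction n generalizing t with
  | zero =>
    obtain ⟨hleft, -⟩ :=
      colour_left_eq_zero_and_of_vMark_eq (legal_pred hx 0 t) (legal_pred hx 1 t) ht
    exact ⟨hleft, trivial⟩
  | succ n ih =>
    obtain ⟨hleft, hbelow | ⟨hfree, hmark⟩⟩ :=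
      colour_left_eq_zero_and_of_vMark_eq (legal_pred hx 0 t) (legal_pred hx 1 t) ht
    · refine ⟨hleft, ?_⟩
      rw [pred_comm]
      exact ih h.2 hbelow
    · refine ⟨hleft, ?_⟩
      cases n with
      | zero => exact ⟨colour_eq_zero_of_hMark_eq (legal_pred hx 1 _) hmark, trivial⟩
      | succ n => exact absurd h.2.1 hfree

lemma hasColumn_of_vMark_eq {x : Point 2 (Letter N)} (hx : x ∈ (columnRules N).sft.carrier)
    {t : Fin 2 → ℤ} {n : ℕ} (h : ∀ i < n, vMark (x (t - Pi.single 0 (i : ℤ))) = some true) :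
    HasColumn x n (t - Pi.single 0 (n : ℤ)) := by
  induction n with
  | zero => trivial
  | succ n ih =>
    have hpred : t - Pi.single 0 ((n + 1 : ℕ) : ℤ) = pred 0 (t - Pi.single 0 (n : ℤ)) := by
      rw [pred, sub_sub, ← Pi.single_add, Nat.cast_succ]
    rw [hpred]
    exact (ih fun i hi => h i (hi.trans n.lt_succ_self)).pred_zero hx (h n n.lt_succ_self)

lemma HasColumn.colour_eq_zero {x : Point 2 (Letter N)} {t : Fin 2 → ℤ} {n : ℕ}
    (h : HasColumn x (n + 1) t) : colour (x (t - Pi.single 1 (n : ℤ))) = 0 := by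
  induction n generalizing t with
  | zero => simpa using h.1
  | succ n ih =>
    have hpred : t - Pi.single 1 ((n + 1 : ℕ) : ℤ) = pred 1 t - Pi.single 1 (n : ℤ) := by
      rw [pred, sub_sub, ← Pi.single_add, Nat.cast_succ, add_comm]
    rw [hpred]
    exact ih h.2

/-- The point whose special letters occupy the sites with `0 ≤ t 0 ≤ t 1 + 1`, so that each column
is one letter shorter than the one to its left. -/
def trianglePoint (a : Fin N) : Point 2 (Letter N) := fun t =>
  if 0 ≤ t 0 ∧ t 0 ≤ t 1 + 1 then
    special (if t 0 = 0 then none else some true)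
      (if t 0 ≤ t 1 then some (decide (t 0 ≠ 0)) else none)
  else free a

lemma hMark_trianglePoint (a : Fin N) (t : Fin 2 → ℤ) : hMark (trianglePoint a t) =
    if 0 ≤ t 0 ∧ t 0 ≤ t 1 + 1 then some (decide (t 0 ≤ t 1)) else none := by
  unfold trianglePoint
  split_ifs <;> simp_all [hMark]

lemma vMark_trianglePoint (a : Fin N) (t : Fin 2 → ℤ) : vMark (trianglePoint a t) =
    if 0 ≤ t 0 ∧ t 0 ≤ t 1 + 1 then some (decide (t 0 ≠ 0)) else none := by
  unfold trianglePoint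
  split_ifs <;> simp_all [vMark]

lemma colour_trianglePoint_eq_zero_iff {a : Fin N} {t : Fin 2 → ℤ} :
    colour (trianglePoint a t) = 0 ↔ 0 ≤ t 0 ∧ t 0 ≤ t 1 + 1 := by
  unfold trianglePoint
  split_ifs <;> simp_all [colour]

lemma trianglePoint_mem_sft (a : Fin N) : trianglePoint a ∈ (columnRules N).sft.carrier := by
  intro t i
  set s : Fin 2 → ℤ := t + Pi.single i 1
  by_cases hmem : 0 ≤ s 0 ∧ s 0 ≤ s 1 + 1
  swap
  · rw [trianglePoint.eq_def a s, if_neg hmem]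
    trivial
  rw [trianglePoint.eq_def a s, if_pos hmem]
  obtain rfl | rfl : i = 0 ∨ i = 1 := by omega
  · have hs0 : s 0 = t 0 + 1 := by simp [s]
    have hs1 : s 1 = t 1 := by simp [s]
    have hle : t 0 ≤ t 1 := by omega
    refine (hMark_trianglePoint a t).trans ?_
    rw [decide_eq_true hle]
    split_ifs <;> grind
  · have hs0 : s 0 = t 0 := by simp [s]
    have hs1 : s 1 = t 1 + 1 := by simp [s]
    refine (vMark_trianglePoint a t).trans ?_
    split_ifs <;> grind

lemma free_mem_sft (a : Fin N) : (fun _ => free a) ∈ (columnRules N).sft.carrier :=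
  fun _ _ => trivial

lemma not_blockGluing_of_trianglePoint_mem {Y : Set (Point 2 (Letter N))}
    (hY : Y ⊆ (columnRules N).sft.carrier) {a : Fin N} (htri : trianglePoint a ∈ Y)
    (hfree : (fun _ => free a) ∈ Y) : ¬ BlockGluing Y := by
  rintro ⟨n, hn⟩
  set c : Fin 2 → ℤ := ![n + 1, n]
  have hdist : ∀ s ∈ Finset.Icc ![1, (n : ℤ)] c, ∀ s' ∈ Finset.Icc (0 : Fin 2 → ℤ) 0,
      (n : ℤ) ≤ siteDist s (s' - 0) := fun s hs s' hs' => by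
    have hs1 : (n : ℤ) ≤ s 1 := (Finset.mem_Icc.1 hs).1 1
    obtain rfl : s' = 0 := by simpa using hs'
    simp only [siteDist, Fin.sum_univ_two, sub_zero, Pi.zero_apply]
    linarith [abs_nonneg (s 0), le_abs_self (s 1)]
  obtain ⟨x, ⟨hx, hxu⟩, y, ⟨-, hyu⟩, hyx⟩ := hn ![1, n] c 0 0
    (by intro i; fin_cases i <;> simp [c]) le_rfl _ ⟨_, htri, rfl⟩ _ ⟨_, hfree, rfl⟩ 0 hdist
  obtain rfl : y = x := by rwa [SymbolicDynamics.FullShift.shift_zero] at hyx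
  have hrow : ∀ i < n + 1, vMark (y (c - Pi.single 0 (i : ℤ))) = some true := fun i hi => by
    set s : Fin 2 → ℤ := c - Pi.single 0 (i : ℤ)
    have h0 : s 0 = n + 1 - i := by simp [s, c, -Matrix.sub_cons, -Matrix.cons_sub]
    have h1 : s 1 = n := by simp [s, c, -Matrix.sub_cons, -Matrix.cons_sub]
    have hs1 : 1 ≤ s 0 := by omega
    have hmem : s ∈ Finset.Icc ![1, (n : ℤ)] c := Finset.mem_Icc.2
      ⟨Fin.forall_fin_two.2 ⟨hs1, h1.ge⟩,
        sub_le_self _ (Pi.single_nonneg.2 (Int.natCast_nonneg i))⟩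
    have hys : y s = trianglePoint a s := congrFun hxu ⟨s, hmem⟩
    rw [hys, vMark_trianglePoint, if_pos (by omega), decide_eq_true (by omega)]
  have hcolour := (hasColumn_of_vMark_eq (hY hx) hrow).colour_eq_zero
  have hzero : c - Pi.single 0 ((n + 1 : ℕ) : ℤ) - Pi.single 1 (n : ℤ) = 0 := by
    ext j
    fin_cases j <;> simp [c, -Matrix.sub_cons, -Matrix.cons_sub]
  have hy0 : y 0 = free a := congrFun hyu ⟨0, by simp⟩
  rw [hzero, hy0] at hcolour
  exact Fin.succ_ne_zero a hcolour

lemma not_blockGluing_support_bernoulliLift (hN : 2 ≤ N) :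
    ¬ BlockGluing (columnRules N).bernoulliLift.support := by
  have hC : 2 < Fintype.card (Fin (N + 1)) := by simpa using Nat.lt_succ_of_le hN
  set a : Fin N := ⟨0, by omega⟩
  refine not_blockGluing_of_trianglePoint_mem (a := a)
    ((columnRules N).support_bernoulliLift_subset hC)
    ((columnRules N).mem_support_bernoulliLift hC (trianglePoint_mem_sft a) (a := ![0, -1])
      fun t ht => ?_)
    ((columnRules N).mem_support_bernoulliLift hC (free_mem_sft a) (a := 0)
      fun t ht => absurd ht (Fin.succ_ne_zero a))
  obtain ⟨h0, h1⟩ := colour_trianglePoint_eq_zero_iff.1 ht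
  have hneg : -1 ≤ t 1 := by omega
  exact Fin.forall_fin_two.2 ⟨h0, hneg⟩

end NearlyFull

theorem mainTheorem8 (ε : ℝ) (hε : 0 < ε) :
    ∃ (A : Type) (_ : Fintype A) (_ : TopologicalSpace A) (_ : DiscreteTopology A)
      (_ : MeasurableSpace A) (_ : BorelSpace A) (R : NearlyFull.NNRules 2 A),
      R.IsFull ε ∧
      ∃ μ : MeasureTheory.Measure (NearlyFull.Point 2 A),
        NearlyFull.IsMME R.sft μ ∧
        (∀ ν : MeasureTheory.Measure (NearlyFull.Point 2 A),
          NearlyFull.IsMME R.sft ν → ν = μ) ∧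
        ¬ NearlyFull.BlockGluing μ.support := by
  obtain ⟨N, hN⟩ := exists_nat_gt (max 2 (9 / ε))
  obtain ⟨hN2, hNε⟩ := max_lt_iff.1 hN
  have hcard : 2 ≤ N := by exact_mod_cast hN2.le
  have hC : 2 < Fintype.card (Fin (N + 1)) := by simpa using Nat.lt_succ_of_le hcard
  have hfull : 9 < ε * (N + 9) := by
    rw [div_lt_iff₀' hε] at hNε
    linarith
  exact ⟨NearlyFull.Letter N, inferInstance, inferInstance, inferInstance, inferInstance,
    inferInstance, (NearlyFull.columnRules N).toNNRules, NearlyFull.isFull_columnRules hfull,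
    (NearlyFull.columnRules N).bernoulliLift, (NearlyFull.columnRules N).isMME_bernoulliLift hC,
    fun _ hν => (NearlyFull.columnRules N).eq_bernoulliLift_of_isMME hC hν,
    NearlyFull.not_blockGluing_support_bernoulliLift hcard⟩
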